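/- Let $E$ be a finite ground set and let $\mathcal P$ be a finite family of subsets of $E$ (called paths), each path $P$ carrying a linear order $<_P$; two paths may have the same elements in a different order. Assume the switching property: for all $P,Q\in\mathcal P$ and $e\in P\cap Q$ there is a path contained in $\{p\in P: p\le_P e\}\cup\{q\in Q: q\ge_Q e\}$. Let $c\in\mathbb R_{\ge 0}^E$ be capacities, $\tau\in\mathbb Z_{\ge 0}^E$ transit times and $T\in\mathbb Z_{\ge 0}$ a time horizon. Write $(P,e)=\{p\in P: p<_P e\}$ and $\mathcal T=\{0,\dots,T-1\}$. *Flows and cuts over time.* The temporal paths are the $P_t$ with $P\in\mathcal P$, $t\in\mathcal T$ and $t+\sum_{p\in P}\tau(p)<T$; the temporal elements of $P_t$ are the pairs $(e,\theta)\in E\times\mathcal T$ with $e\in P$ and $\theta=t+\sum_{p\in(P,e)}\tau(p)$. An abstract flow over time assigns a number $x(P_t)\ge 0$ to every temporal path such that $\sum_{P_t\ni(e,\theta)}x(P_t)\le c(e)$ for all $(e,\theta)\in E\times\mathcal T$; its value is $\sum_{P_t}x(P_t)$. An abstract cut over time is a set $C\subseteq E\times\mathcal T$ that meets every temporal path; its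 capacity is $\sum_{(e,\theta)\in C}c(e)$. *Static problem.* Put $r(P)=T-\sum_{e\in P}\tau(e)$ and consider the linear program of maximizing $\sum_{P}r(P)\tilde x(P)$ subject to $\sum_{P\ni e}\tilde x(P)\le c(e)$ for all $e\in E$ and $\tilde x\ge 0$, and its dual of minimizing $\sum_{e}c(e)\tilde y(e)$ subject to $\sum_{e\in P}\tilde y(e)\ge r(P)$ for all $P\in\mathcal P$ and $\tilde y\ge 0$. Then: 1. For every optimal solution $\tilde x^*$ of the static maximization problem, the temporally repeated flow $x^*$, given by $x^*(P_t)=\tilde x^*(P)$ for all temporal paths $P_t$, is a maximum abstract flow over time. 2. For every integral optimal solution $\tilde y$ of the dual problem, put $\alpha(e)=\min_{P\in\mathcal P:\,e\in P}\sum_{p\in(P,e)}(\tau(p)+\tilde y(p))$ (with $\alpha(e)=\infty$ if $e$ lies on no path). Then $$C=\{(e,\theta)\in E\times\mathcal T:\ \alpha(e)\le\theta<\alpha(e)+\tilde y(e)\}$$ is a minimum abstract cut over time, and its capacity equals the value of $x^*$, for every $x^*$ as in 1. 3. If all paths are non-empty, then an optimal solution $\tilde x^*$ and an integral optimal dual solution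 $\tilde y$ as in 1 and 2 exist. -/

import Mathlib

/-- An abstract network: finite, linearly ordered subsets of a ground set `E`, called paths and
indexed by `ι` (so two paths may have the same elements in a different order), that satisfy the
switching property. `lt P` is the order `<_P`; only its values on `elems P` matter. -/
structure AbstractNetwork (E ι : Type*) where
  /-- the set of elements of a path -/
  elems : ι → Finset E
  /-- the strict order of a path -/
  lt : ι → E → E → Prop
  lt_irrefl : ∀ P, ∀ a ∈ elems P, ¬ lt P a a
  lt_trans : ∀ P, ∀ a ∈ elems P, ∀ b ∈ elems P, ∀ d ∈ elems P, lt P a b → lt P b d → lt P a d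
  lt_total : ∀ P, ∀ a ∈ elems P, ∀ b ∈ elems P, a ≠ b → lt P a b ∨ lt P b a
  /-- some path is contained in the part of `P` up to `e` and the part of `Q` from `e` on -/
  switching : ∀ P Q, ∀ e, e ∈ elems P → e ∈ elems Q → ∃ R, ∀ a ∈ elems R,
    (a ∈ elems P ∧ (a = e ∨ lt P a e)) ∨ (a ∈ elems Q ∧ (a = e ∨ lt Q e a))

namespace AbstractNetwork

variable {E ι : Type*}

/-! ### The static problems -/

open Classical in
/-- `x` is a feasible static abstract flow. -/
def IsFlow [Fintype ι] (N : AbstractNetwork E ι) (c : E → ℝ) (x : ι → ℝ) : Prop :=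
  (∀ P, 0 ≤ x P) ∧ ∀ e, ∑ P with e ∈ N.elems P, x P ≤ c e

/-- `x` is an optimal solution of the maximum weighted abstract flow problem with weights `r`. -/
def IsMaxWeightedFlow [Fintype ι] (N : AbstractNetwork E ι) (c : E → ℝ) (r : ι → ℝ)
    (x : ι → ℝ) : Prop :=
  N.IsFlow c x ∧ ∀ x', N.IsFlow c x' → ∑ P, r P * x' P ≤ ∑ P, r P * x P

/-- `y` is a feasible weighted abstract cut (a feasible solution of the dual problem). -/
def IsWeightedCut (N : AbstractNetwork E ι) (r : ι → ℝ) (y : E → ℝ) : Prop :=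
  (∀ e, 0 ≤ y e) ∧ ∀ P, r P ≤ ∑ e ∈ N.elems P, y e

/-- `y` is an optimal solution of the minimum weighted abstract cut problem with weights `r`. -/
def IsMinWeightedCut [Fintype E] (N : AbstractNetwork E ι) (c : E → ℝ) (r : ι → ℝ)
    (y : E → ℝ) : Prop :=
  N.IsWeightedCut r y ∧ ∀ y', N.IsWeightedCut r y' → ∑ e, c e * y e ≤ ∑ e, c e * y' e

/-! ### The time expansion -/

open Classical in
/-- The elements of the path `P` that strictly precede `e` on `P`. -/
noncomputable def before (N : AbstractNetwork E ι) (P : ι) (e : E) : Finset E :=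
  (N.elems P).filter fun p => N.lt P p e

/-- The temporal paths `P_t`: a path `P` and a starting time `t ∈ {0, …, T - 1}` with arrival time
less than `T`. -/
abbrev TemporalPath (N : AbstractNetwork E ι) (τ : E → ℕ) (T : ℕ) : Type _ :=
  {p : ι × Fin T // (p.2 : ℕ) + ∑ e ∈ N.elems p.1, τ e < T}

/-- The set of temporal elements `(e, θ) ∈ E × {0, …, T - 1}` of a temporal path. -/
def TemporalPath.elems {N : AbstractNetwork E ι} {τ : E → ℕ} {T : ℕ}
    (p : N.TemporalPath τ T) : Set (E × Fin T) :=
  {a | a.1 ∈ N.elems p.1.1 ∧ (a.2 : ℕ) = (p.1.2 : ℕ) + ∑ q ∈ N.before p.1.1 a.1, τ q}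

open Classical in
/-- `x` is a feasible abstract flow over time. -/
def IsFlowOverTime [Fintype ι] (N : AbstractNetwork E ι) (c : E → ℝ) (τ : E → ℕ) (T : ℕ)
    (x : N.TemporalPath τ T → ℝ) : Prop :=
  (∀ p, 0 ≤ x p) ∧ ∀ (e : E) (θ : Fin T),
    ∑ p : N.TemporalPath τ T with (e, θ) ∈ TemporalPath.elems p, x p ≤ c e

/-- `x` is a maximum abstract flow over time. -/
def IsMaxFlowOverTime [Fintype ι] (N : AbstractNetwork E ι) (c : E → ℝ) (τ : E → ℕ) (T : ℕ)
    (x : N.TemporalPath τ T → ℝ) : Prop :=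
  N.IsFlowOverTime c τ T x ∧ ∀ x', N.IsFlowOverTime c τ T x' → ∑ p, x' p ≤ ∑ p, x p

/-- `C` is an abstract cut over time: it meets every temporal path. -/
def IsCutOverTime (N : AbstractNetwork E ι) (τ : E → ℕ) (T : ℕ) (C : Finset (E × Fin T)) : Prop :=
  ∀ p : N.TemporalPath τ T, ∃ a ∈ C, a ∈ TemporalPath.elems p

/-- `C` is an abstract cut over time of minimum capacity. -/
def IsMinCutOverTime (N : AbstractNetwork E ι) (c : E → ℝ) (τ : E → ℕ) (T : ℕ)
    (C : Finset (E × Fin T)) : Prop :=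
  N.IsCutOverTime τ T C ∧
    ∀ C' : Finset (E × Fin T), N.IsCutOverTime τ T C' → ∑ a ∈ C, c a.1 ≤ ∑ a ∈ C', c a.1

/-! ### The temporally repeated flow and the cut -/

/-- The weight `r(P) = T - ∑_{e ∈ P} τ(e)`, as a real number (possibly negative). -/
def weight (N : AbstractNetwork E ι) (τ : E → ℕ) (T : ℕ) (P : ι) : ℝ :=
  (T : ℝ) - ∑ e ∈ N.elems P, (τ e : ℝ)

/-- The temporally repeated flow of `x`: it sends `x P` along every temporal copy of `P`, that is,
for all starting times `0 ≤ t < T - ∑_{e ∈ P} τ(e)`. -/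
def temporallyRepeated (N : AbstractNetwork E ι) (τ : E → ℕ) (T : ℕ) (x : ι → ℝ) :
    N.TemporalPath τ T → ℝ :=
  fun p => x p.1.1

/-- The time `α(e)` at which `e` enters the cut: the minimum of `∑ (τ(p) + y(p))` over the elements
`p` preceding `e` on `P`, among all paths `P` containing `e` (`∞` if there is no such path). -/
noncomputable def entryTime (N : AbstractNetwork E ι) (τ : E → ℕ) (y : E → ℕ) (e : E) : ℕ∞ :=
  ⨅ (P : ι) (_ : e ∈ N.elems P), ((∑ p ∈ N.before P e, (τ p + y p) : ℕ) : ℕ∞)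

open Classical in
/-- The set `C` of all `(e, θ)` with `θ ∈ {0, …, T - 1}` and `α(e) ≤ θ < α(e) + y(e)`. -/
noncomputable def cutOverTime [Fintype E] (N : AbstractNetwork E ι) (τ : E → ℕ) (T : ℕ)
    (y : E → ℕ) : Finset (E × Fin T) :=
  {a | N.entryTime τ y a.1 ≤ ((a.2 : ℕ) : ℕ∞) ∧
    ((a.2 : ℕ) : ℕ∞) < N.entryTime τ y a.1 + (y a.1 : ℕ∞)}

end AbstractNetwork

/-! The proof is a chain of weak dualities closed by an integral strong duality. For any flow over
time `x'`, any static optimum `x` and an integral weighted cut `y` of cost `∑ r x`, value of `x'` ≤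
capacity of the cut over time of `y` ≤ `∑ c y` = `∑ r x` ≤ value of `x` repeated over time. Weak
duality over time closes the circle.

The combinatorial core is `exists_mem_window`, the only place where switching is used: a path
traversed in time must pass some element `e` during `[α e, α e + y e)`. For integral `y` this says
that the windows form a cut over time. It is proved for real data because it also yields integrality
of the dual: intersecting the windows of a fractional cut with a randomly shifted integer lattice
gives an integral weighted cut whose expected cost is the fractional cost
(`exists_nat_isWeightedCut_le`). Fractional duality itself comes from separating a point from a
closed cone.

An empty path makes the static problems unbounded or infeasible unless `T = 0`, so non-emptiness may
be assumed apart from that trivial case. -/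

namespace AbstractNetwork

/-! ### Path orders and the time-window lemma -/

section Order

variable {E ι : Type*} (N : AbstractNetwork E ι)

theorem mem_before {P : ι} {e a : E} : a ∈ N.before P e ↔ a ∈ N.elems P ∧ N.lt P a e := by
  simp [before]

theorem card_before_lt {P : ι} {a b : E} (ha : a ∈ N.elems P) (hb : b ∈ N.elems P)
    (h : N.lt P a b) : (N.before P a).card < (N.before P b).card := by
  refine Finset.card_lt_card (Finset.ssubset_iff_of_subset ?_ |>.2 ⟨a, ?_, ?_⟩)
  · intro d hd
    rw [mem_before] at hd ⊢
    exact ⟨hd.1, N.lt_trans P d hd.1 a ha b hb hd.2 h⟩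
  · exact N.mem_before.2 ⟨ha, h⟩
  · exact fun h' => N.lt_irrefl P a ha (N.mem_before.1 h').2

/-- A non-empty set of elements of a path has a first element. -/
theorem exists_first {P : ι} {S : Finset E} (hS : S ⊆ N.elems P) (hne : S.Nonempty) :
    ∃ m ∈ S, ∀ a ∈ S, ¬ N.lt P a m := by
  obtain ⟨m, hm, h⟩ := S.exists_min_image (fun a => (N.before P a).card) hne
  exact ⟨m, hm, fun a ha hlt => (h a ha).not_gt (N.card_before_lt (hS ha) (hS hm) hlt)⟩

/-- A non-empty set of elements of a path has a last element. -/
theorem exists_last {P : ι} {S : Finset E} (hS : S ⊆ N.elems P) (hne : S.Nonempty) :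
    ∃ m ∈ S, ∀ a ∈ S, ¬ N.lt P m a := by
  obtain ⟨m, hm, h⟩ := S.exists_max_image (fun a => (N.before P a).card) hne
  exact ⟨m, hm, fun a ha hlt => (h a ha).not_gt (N.card_before_lt (hS hm) (hS ha) hlt)⟩

theorem notMem_before_self {P : ι} {e : E} (he : e ∈ N.elems P) : e ∉ N.before P e :=
  fun h => N.lt_irrefl P e he (N.mem_before.1 h).2

/-- Let `y` be a fractional weighted abstract cut and `α e` the shortest length, with respect to
`τ + y`, of a path up to `e`. A path traversed from time `s` on with arrival time less than `T`
uses one of its elements `e` during the time window `[α e, α e + y e)`. -/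
theorem exists_mem_window {τ y α : E → ℝ} {T : ℝ} (hτ : ∀ e, 0 ≤ τ e) (hy : ∀ e, 0 ≤ y e)
    (hT : ∀ P, T ≤ ∑ e ∈ N.elems P, (τ e + y e))
    (hα : ∀ P, ∀ e ∈ N.elems P, α e ≤ ∑ p ∈ N.before P e, (τ p + y p))
    (hα' : ∀ P, ∀ e ∈ N.elems P, ∃ Q, e ∈ N.elems Q ∧ ∑ p ∈ N.before Q e, (τ p + y p) = α e)
    (P : ι) {s : ℝ} (hs : 0 ≤ s) (hsT : s + ∑ e ∈ N.elems P, τ e < T) :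
    ∃ e ∈ N.elems P, α e ≤ s + ∑ p ∈ N.before P e, τ p ∧
      s + ∑ p ∈ N.before P e, τ p < α e + y e := by
  classical
  by_contra! hcon
  have hl : ∀ e, 0 ≤ τ e + y e := fun e => add_nonneg (hτ e) (hy e)
  have hne : (N.elems P).Nonempty := by
    rw [Finset.nonempty_iff_ne_empty]
    intro h
    have := hT P
    simp only [h, Finset.sum_empty] at this hsT
    linarith
  obtain ⟨e₀, he₀, hfirst⟩ := N.exists_first subset_rfl hne
  have hb₀ : N.before P e₀ = ∅ := by
    rw [Finset.eq_empty_iff_forall_notMem]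
    intro a ha
    rw [mem_before] at ha
    exact hfirst a ha.1 ha.2
  -- Take the last element of `P` reached no earlier than its window opens. By `hcon` its window has
  -- already closed, so following `Q` up to `e` and then `P` is no slower in length `τ + y` than the
  -- actual traversal.
  obtain ⟨e, heS, hlast⟩ := N.exists_last
    (S := (N.elems P).filter fun e => α e ≤ s + ∑ p ∈ N.before P e, τ p)
    (Finset.filter_subset _ _) ⟨e₀, by
      refine Finset.mem_filter.2 ⟨he₀, ?_⟩
      have := hα P e₀ he₀
      rw [hb₀, Finset.sum_empty] at this ⊢
      linarith⟩
  obtain ⟨heP, hreach⟩ := Finset.mem_filter.1 heS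
  have hpassed := hcon e heP hreach
  obtain ⟨Q, heQ, hQ⟩ := hα' P e heP
  obtain ⟨R, hR⟩ := N.switching Q P e heQ heP
  have hsumQ : ∑ p ∈ insert e (N.before Q e), (τ p + y p) = τ e + y e + α e := by
    rw [Finset.sum_insert (N.notMem_before_self heQ), hQ]
  have hsumP : ∑ p ∈ insert e (N.before P e), τ p = τ e + ∑ p ∈ N.before P e, τ p :=
    Finset.sum_insert (N.notMem_before_self heP)
  -- If `R` avoids the part of `P` after `e`, its length is too small to reach `T`. Otherwise its
  -- first element `f` in that part has a small `α f`, so `P` reaches `f` after its window opens,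
  -- contradicting the choice of `e`.
  rcases ((N.elems R).filter fun a => a ∈ N.elems P ∧ N.lt P e a).eq_empty_or_nonempty with
    hF | hF
  · have h1 : N.elems R ⊆ insert e (N.before Q e) := by
      intro a ha
      rw [Finset.mem_insert, mem_before]
      rcases hR a ha with ⟨h1, h2⟩ | ⟨h1, h2⟩
      · tauto
      · rcases h2 with h2 | h2
        · exact Or.inl h2
        · exact absurd (Finset.mem_filter.2 ⟨ha, h1, h2⟩) (hF ▸ Finset.notMem_empty a)
    have h2 : insert e (N.before P e) ⊆ N.elems P :=
      Finset.insert_subset heP (Finset.filter_subset _ _)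
    have h3 := Finset.sum_le_sum_of_subset_of_nonneg h1 (fun a _ _ => hl a)
    have h4 := Finset.sum_le_sum_of_subset_of_nonneg h2 (fun a _ _ => hτ a)
    have := hT R
    linarith
  · obtain ⟨f, hfF, hfirstR⟩ := N.exists_first (Finset.filter_subset _ _) hF
    obtain ⟨hfR, hfP, hef⟩ := Finset.mem_filter.1 hfF
    have h1 : N.before R f ⊆ insert e (N.before Q e) := by
      intro a ha
      rw [mem_before] at ha
      rw [Finset.mem_insert, mem_before]
      rcases hR a ha.1 with ⟨h1, h2⟩ | ⟨h1, h2⟩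
      · tauto
      · rcases h2 with h2 | h2
        · exact Or.inl h2
        · exact absurd ha.2 (hfirstR a (Finset.mem_filter.2 ⟨ha.1, h1, h2⟩))
    have h2 : insert e (N.before P e) ⊆ N.before P f := by
      refine Finset.insert_subset (N.mem_before.2 ⟨heP, hef⟩) fun a ha => ?_
      rw [mem_before] at ha ⊢
      exact ⟨ha.1, N.lt_trans P a ha.1 e heP f hfP ha.2 hef⟩
    have h3 := Finset.sum_le_sum_of_subset_of_nonneg h1 (fun a _ _ => hl a)
    have h4 := Finset.sum_le_sum_of_subset_of_nonneg h2 (fun a _ _ => hτ a)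
    have h5 := hα R f hfR
    exact hlast f (Finset.mem_filter.2 ⟨hfP, by linarith⟩) hef

end Order

/-! ### Static linear programming duality -/

section StaticDuality

variable {E ι : Type*} [Fintype ι] (N : AbstractNetwork E ι)

theorem sum_mul_sum_elems [Fintype E] (y : E → ℝ) (x : ι → ℝ) :
    ∑ P, (∑ e ∈ N.elems P, y e) * x P =
      ∑ e, y e * (open Classical in ∑ P with e ∈ N.elems P, x P) := by
  classical
  simp_rw [Finset.sum_mul, Finset.mul_sum, Finset.sum_filter]
  rw [Finset.sum_comm]
  refine Finset.sum_congr rfl fun P _ => ?_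
  rw [← Finset.sum_filter]
  refine Finset.sum_congr ?_ fun _ _ => rfl
  ext; simp

/-- Weak duality. -/
theorem IsFlow.sum_le [Fintype E] {c : E → ℝ} {r x : ι → ℝ} {y : E → ℝ} (hx : N.IsFlow c x)
    (hy : N.IsWeightedCut r y) : ∑ P, r P * x P ≤ ∑ e, c e * y e := by
  calc ∑ P, r P * x P ≤ ∑ P, (∑ e ∈ N.elems P, y e) * x P :=
        Finset.sum_le_sum fun P _ => mul_le_mul_of_nonneg_right (hy.2 P) (hx.1 P)
    _ = _ := N.sum_mul_sum_elems y x
    _ ≤ ∑ e, c e * y e := Finset.sum_le_sum fun e _ => by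
        rw [mul_comm (c e)]
        exact mul_le_mul_of_nonneg_left (hx.2 e) (hy.1 e)

theorem IsFlow.le_capacity {c : E → ℝ} {x : ι → ℝ} (hx : N.IsFlow c x) {P : ι} {e : E}
    (he : e ∈ N.elems P) : x P ≤ c e := by
  classical
  refine le_trans ?_ (hx.2 e)
  exact Finset.single_le_sum (f := x) (fun Q _ => hx.1 Q) (by simp [he])

theorem isClosed_setOf_isFlow : IsClosed {p : (E → ℝ) × (ι → ℝ) | N.IsFlow p.1 p.2} := by
  classical
  have : {p : (E → ℝ) × (ι → ℝ) | N.IsFlow p.1 p.2} = (⋂ P, {p | 0 ≤ p.2 P}) ∩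
      ⋂ e, {p | ∑ P with e ∈ N.elems P, p.2 P ≤ p.1 e} := by
    ext p
    simp only [IsFlow, Set.mem_ofPred_eq, Set.mem_inter_iff, Set.mem_iInter]
  rw [this]
  exact (isClosed_iInter fun P => isClosed_le (by fun_prop) (by fun_prop)).inter
    (isClosed_iInter fun e => isClosed_le (by fun_prop) (by fun_prop))

theorem isFlow_zero {c : E → ℝ} (hc : ∀ e, 0 ≤ c e) : N.IsFlow c (0 : ι → ℝ) :=
  ⟨fun _ => le_rfl, fun e => by simpa using hc e⟩

theorem exists_isMaxWeightedFlow {c : E → ℝ} (hc : ∀ e, 0 ≤ c e)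
    (hne : ∀ P, (N.elems P).Nonempty) (r : ι → ℝ) : ∃ x, N.IsMaxWeightedFlow c r x := by
  have hclosed : IsClosed {x | N.IsFlow c x} :=
    N.isClosed_setOf_isFlow.preimage (f := fun x : ι → ℝ => (c, x)) (by fun_prop)
  choose g hg using hne
  have hcomp : IsCompact {x | N.IsFlow c x} :=
    (isCompact_Icc (a := (0 : ι → ℝ)) (b := fun P => c (g P))).of_isClosed_subset hclosed
      fun x hx => ⟨hx.1, fun P => hx.le_capacity N (hg P)⟩
  obtain ⟨x, hx, hmax⟩ := hcomp.exists_isMaxOn ⟨0, N.isFlow_zero hc⟩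
    (f := fun x => ∑ P, r P * x P) (by fun_prop)
  exact ⟨x, hx, fun x' hx' => hmax hx'⟩

/-- The cone of all `(v, s)` such that the value `s` is attainable under the capacities `v`. -/
def valueCone (r : ι → ℝ) : Set ((E → ℝ) × ℝ) :=
  {p | ∃ x, N.IsFlow p.1 x ∧ p.2 ≤ ∑ P, r P * x P}

/-- Along a convergent sequence the capacities are bounded, and non-empty paths pass this bound on
to the flows, so the witnesses have a convergent subsequence. -/
theorem isClosed_valueCone [Fintype E] (hne : ∀ P, (N.elems P).Nonempty) (r : ι → ℝ) :
    IsClosed (N.valueCone r) := by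
  choose g hg using hne
  refine IsSeqClosed.isClosed fun u p hu hup => ?_
  choose x hx hxs using hu
  have hv : Filter.Tendsto (fun n => (u n).1) Filter.atTop (nhds p.1) :=
    (continuous_fst.tendsto p).comp hup
  obtain ⟨M, hM⟩ := (Metric.isBounded_range_of_tendsto _ hv).exists_norm_le
  have hbd : ∀ n, x n ∈ Set.Icc (0 : ι → ℝ) (fun _ => M) := fun n =>
    ⟨(hx n).1, fun P => ((hx n).le_capacity N (hg P)).trans <|
      (le_abs_self _).trans <| (norm_le_pi_norm (u n).1 (g P)).trans (hM _ ⟨n, rfl⟩)⟩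
  obtain ⟨x₀, -, φ, hφ, hlim⟩ := isCompact_Icc.tendsto_subseq hbd
  have hup' := hup.comp hφ.tendsto_atTop
  refine ⟨x₀, ?_, ?_⟩
  · exact N.isClosed_setOf_isFlow.mem_of_tendsto
      ((hv.comp hφ.tendsto_atTop).prodMk_nhds hlim) (Filter.Eventually.of_forall fun n => hx (φ n))
  · refine le_of_tendsto_of_tendsto' ((continuous_snd.tendsto p).comp hup')
      (((by fun_prop : Continuous fun x : ι → ℝ => ∑ P, r P * x P).tendsto x₀).comp hlim)
      fun n => hxs (φ n)

theorem convex_valueCone (r : ι → ℝ) : Convex ℝ (N.valueCone r) := by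
  classical
  rintro p ⟨x, hx, hxs⟩ q ⟨z, hz, hzs⟩ a b ha hb -
  refine ⟨a • x + b • z, ⟨fun P => ?_, fun e => ?_⟩, ?_⟩
  · exact add_nonneg (mul_nonneg ha (hx.1 P)) (mul_nonneg hb (hz.1 P))
  · simp only [Pi.add_apply, Pi.smul_apply, smul_eq_mul, Finset.sum_add_distrib,
      ← Finset.mul_sum, Prod.fst_add, Prod.smul_fst]
    exact add_le_add (mul_le_mul_of_nonneg_left (hx.2 e) ha)
      (mul_le_mul_of_nonneg_left (hz.2 e) hb)
  · have : ∑ P, r P * (a • x + b • z) P = a * ∑ P, r P * x P + b * ∑ P, r P * z P := by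
      rw [Finset.mul_sum, Finset.mul_sum, ← Finset.sum_add_distrib]
      refine Finset.sum_congr rfl fun P _ => ?_
      simp only [Pi.add_apply, Pi.smul_apply, smul_eq_mul]
      ring
    rw [this]
    exact add_le_add (mul_le_mul_of_nonneg_left hxs ha) (mul_le_mul_of_nonneg_left hzs hb)

theorem smul_mem_valueCone {r : ι → ℝ} {p : (E → ℝ) × ℝ} (hp : p ∈ N.valueCone r) {a : ℝ}
    (ha : 0 ≤ a) : a • p ∈ N.valueCone r := by
  obtain ⟨x, hx, hxs⟩ := hp
  refine ⟨a • x, ⟨fun P => mul_nonneg ha (hx.1 P), fun e => ?_⟩, ?_⟩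
  · simp only [Pi.smul_apply, smul_eq_mul, ← Finset.mul_sum, Prod.smul_fst]
    exact mul_le_mul_of_nonneg_left (hx.2 e) ha
  · simp only [Pi.smul_apply, smul_eq_mul, Prod.smul_snd, mul_left_comm, ← Finset.mul_sum]
    exact mul_le_mul_of_nonneg_left hxs ha

/-- Strong duality, up to an arbitrarily small error. -/
theorem exists_isWeightedCut_lt [Fintype E] {c : E → ℝ} (hc : ∀ e, 0 ≤ c e)
    (hne : ∀ P, (N.elems P).Nonempty) {r x : ι → ℝ} (hx : N.IsMaxWeightedFlow c r x) {B : ℝ}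
    (hB : ∑ P, r P * x P < B) : ∃ y, N.IsWeightedCut r y ∧ ∑ e, c e * y e < B := by
  classical
  have hnot : (c, B) ∉ N.valueCone r := by
    rintro ⟨x', hx', h⟩
    have := hx.2 x' hx'
    simp only at h
    linarith
  obtain ⟨f, u, hfu, hu⟩ := geometric_hahn_banach_closed_point (N.convex_valueCone r)
    (N.isClosed_valueCone hne r) hnot
  have hu0 : 0 < u := by
    simpa using hfu 0 ⟨0, N.isFlow_zero fun _ => le_rfl, by simp⟩
  -- A positive value could be scaled to exactly `u`, against the strict separation.
  have hf : ∀ p ∈ N.valueCone r, f p ≤ 0 := by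
    intro p hp
    by_contra! h
    have := hfu _ (N.smul_mem_valueCone hp (div_pos hu0 h).le)
    rw [map_smul, smul_eq_mul, div_mul_cancel₀ _ h.ne'] at this
    exact this.false
  have hrep : ∀ (v : E → ℝ) (s : ℝ),
      f (v, s) = ∑ e, v e * f (Pi.single e 1, 0) + s * f (0, 1) := by
    intro v s
    have h1 : (v, s) = ∑ e, v e • ((Pi.single e 1, 0) : (E → ℝ) × ℝ) + s • (0, 1) := by
      ext
      · simp [Prod.fst_sum, Finset.sum_apply, Pi.single_apply]
      · simp [Prod.snd_sum]
    rw [h1, map_add, map_sum, map_smul]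
    simp only [map_smul, smul_eq_mul]
  have hy0 : ∀ e, f (Pi.single e 1, 0) ≤ 0 := fun e => by
    refine hf _ ⟨0, N.isFlow_zero fun a => ?_, by simp⟩
    by_cases h : a = e <;> simp [h]
  have hμ0 : 0 ≤ f (0, 1) := by
    have := hf (0, -1) ⟨0, N.isFlow_zero fun _ => le_rfl, by simp⟩
    rw [hrep] at this
    simpa using this
  have hB' : 0 < ∑ e, c e * f (Pi.single e 1, 0) + B * f (0, 1) := by
    rw [← hrep]
    exact hu0.trans hu
  -- With `f (0, 1) = 0` the point `(c, B)` would have a non-positive value, since `c ≥ 0`.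
  have hμ : 0 < f (0, 1) := by
    refine hμ0.lt_of_ne fun h => ?_
    rw [← h, mul_zero, add_zero] at hB'
    exact hB'.not_ge (Finset.sum_nonpos fun e _ => mul_nonpos_of_nonneg_of_nonpos (hc e) (hy0 e))
  refine ⟨fun e => -f (Pi.single e 1, 0) / f (0, 1),
    ⟨fun e => div_nonneg (neg_nonneg.2 (hy0 e)) hμ0, fun P => ?_⟩, ?_⟩
  · have h1 := hf (fun e => if e ∈ N.elems P then 1 else 0, r P) ⟨Pi.single P 1, ⟨?_, ?_⟩, ?_⟩
    · rw [hrep] at h1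
      simp only [ite_mul, one_mul, zero_mul, Finset.sum_ite_mem, Finset.univ_inter] at h1
      rw [← Finset.sum_div, le_div_iff₀ hμ, Finset.sum_neg_distrib]
      linarith
    · intro Q
      by_cases h : Q = P <;> simp [h]
    · intro e
      simp only [Pi.single_apply]
      rw [Finset.sum_ite_eq']
      simp
    · simp [Pi.single_apply]
  · have h2 : ∑ e, c e * (-f (Pi.single e 1, 0) / f (0, 1)) =
        -(∑ e, c e * f (Pi.single e 1, 0)) / f (0, 1) := by
      rw [← Finset.sum_neg_distrib, Finset.sum_div]
      exact Finset.sum_congr rfl fun e _ => by ring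
    rw [h2, div_lt_iff₀ hμ]
    linarith

end StaticDuality

/-! ### Integrality of the dual by randomized rounding -/

section Rounding

/-- Since `⌈u⌉ = u + fract (-u)` and the second term is periodic, its mean over a unit interval is
independent of the shift and cancels. -/
theorem integral_ceil_add_sub_ceil_add (a b : ℝ) :
    ∫ u in (0 : ℝ)..1, ((⌈b + u⌉ : ℝ) - ⌈a + u⌉) = b - a := by
  have hper : Function.Periodic (fun u : ℝ => Int.fract (-u)) 1 := fun u => by
    change Int.fract (-(u + 1)) = Int.fract (-u)
    rw [neg_add, ← sub_eq_add_neg, Int.fract_sub_one]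
  have hmeas : Measurable fun u : ℝ => Int.fract (-u) := measurable_fract.comp measurable_neg
  have hint : ∀ d, IntervalIntegrable (fun u : ℝ => Int.fract (-(d + u)))
      MeasureTheory.volume 0 1 := by
    intro d
    refine (intervalIntegrable_const (c := (1 : ℝ))).mono_fun
      (hmeas.comp (measurable_const_add d)).aestronglyMeasurable
      (Filter.Eventually.of_forall fun u => ?_)
    simp only [Real.norm_eq_abs, Int.abs_fract, abs_one]
    exact (Int.fract_lt_one _).le
  have hconst : ∀ d, ∫ u in (0 : ℝ)..1, Int.fract (-(d + u)) =
      ∫ u in (0 : ℝ)..1, Int.fract (-u) := by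
    intro d
    rw [intervalIntegral.integral_comp_add_left (fun u => Int.fract (-u)) d]
    simpa using hper.intervalIntegral_add_eq d 0
  have hceil : ∀ u : ℝ, (⌈u⌉ : ℝ) = u + Int.fract (-u) := by
    intro u
    rw [← Int.self_sub_floor, Int.floor_neg]
    push_cast
    ring
  have : ∀ u : ℝ, (⌈b + u⌉ : ℝ) - ⌈a + u⌉ =
      (b - a) + (Int.fract (-(b + u)) - Int.fract (-(a + u))) := by
    intro u
    rw [hceil, hceil]
    ring
  simp_rw [this]
  rw [intervalIntegral.integral_add intervalIntegrable_const ((hint b).sub (hint a)),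
    intervalIntegral.integral_sub (hint b) (hint a), hconst, hconst]
  simp

theorem intervalIntegrable_ceil_add (a : ℝ) :
    IntervalIntegrable (fun u : ℝ => (⌈a + u⌉ : ℝ)) MeasureTheory.volume 0 1 := by
  refine Monotone.intervalIntegrable fun u v h => ?_
  exact_mod_cast Int.ceil_mono (by linarith)

variable {E ι : Type*} (N : AbstractNetwork E ι)

/-- For every element `e` lying on some path, the shortest length of a path up to `e` exists. -/
theorem exists_shortest_before [Finite ι] (l : E → ℝ) : ∃ α : E → ℝ,
    (∀ P, ∀ e ∈ N.elems P, α e ≤ ∑ p ∈ N.before P e, l p) ∧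
    ∀ P, ∀ e ∈ N.elems P, ∃ Q, e ∈ N.elems Q ∧ ∑ p ∈ N.before Q e, l p = α e := by
  have (e : E) : ∃ a : ℝ, (∀ P, e ∈ N.elems P → a ≤ ∑ p ∈ N.before P e, l p) ∧
      ∀ P, e ∈ N.elems P → ∃ Q, e ∈ N.elems Q ∧ ∑ p ∈ N.before Q e, l p = a := by
    by_cases h : ∃ P, e ∈ N.elems P
    · obtain ⟨Q, hQ, hmin⟩ := Set.exists_min_image {P | e ∈ N.elems P}
        (fun P => ∑ p ∈ N.before P e, l p) (Set.toFinite _) h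
      exact ⟨_, hmin, fun _ _ => ⟨Q, hQ, rfl⟩⟩
    · exact ⟨0, fun P hP => absurd ⟨P, hP⟩ h, fun P hP => absurd ⟨P, hP⟩ h⟩
  choose α h1 h2 using this
  exact ⟨α, fun P e => h1 e P, fun P e => h2 e P⟩

theorem weight_le_sum_iff {τ : E → ℕ} {T : ℕ} {y : E → ℝ} {P : ι} :
    N.weight τ T P ≤ ∑ e ∈ N.elems P, y e ↔ (T : ℝ) ≤ ∑ e ∈ N.elems P, ((τ e : ℝ) + y e) := by
  rw [weight, Finset.sum_add_distrib, sub_le_iff_le_add']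

/-- Rounding a fractional weighted abstract cut with the threshold `u`. -/
theorem isWeightedCut_ceil_sub_ceil {τ : E → ℕ} {T : ℕ} {y α : E → ℝ}
    (hy : N.IsWeightedCut (N.weight τ T) y)
    (hα : ∀ P, ∀ e ∈ N.elems P, α e ≤ ∑ p ∈ N.before P e, (τ p + y p))
    (hα' : ∀ P, ∀ e ∈ N.elems P, ∃ Q, e ∈ N.elems Q ∧ ∑ p ∈ N.before Q e, (τ p + y p) = α e)
    {u : ℝ} (hu0 : 0 < u) (hu1 : u ≤ 1) :
    N.IsWeightedCut (N.weight τ T) fun e => ((⌈α e + y e + u⌉ - ⌈α e + u⌉).toNat : ℝ) := by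
  classical
  refine ⟨fun e => Nat.cast_nonneg _, fun P => ?_⟩
  obtain hr | hr := le_total (T : ℤ) (∑ e ∈ N.elems P, τ e : ℕ)
  · have : N.weight τ T P ≤ 0 := by
      rw [weight, sub_nonpos]
      exact_mod_cast hr
    exact this.trans (Finset.sum_nonneg fun e _ => Nat.cast_nonneg _)
  -- Start `P` at each time `n - u` with `1 ≤ n ≤ r(P)`; `u ≤ 1` makes this non-negative and `u > 0`
  -- makes it arrive before `T`. Each start hits a window, and the window of `e` is hit by at most
  -- as many starts as its rounded value.
  have hsub : Finset.Icc (1 : ℤ) (T - (∑ e ∈ N.elems P, τ e : ℕ)) ⊆ (N.elems P).biUnion fun e =>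
      (Finset.Ico ⌈α e + u⌉ ⌈α e + y e + u⌉).image
        fun m => m - (∑ p ∈ N.before P e, τ p : ℕ) := by
    intro n hn
    rw [Finset.mem_Icc] at hn
    have h1 : (1 : ℝ) ≤ n := by exact_mod_cast hn.1
    have h2 : (n : ℝ) ≤ T - ∑ e ∈ N.elems P, (τ e : ℝ) := by exact_mod_cast hn.2
    obtain ⟨e, he, h3, h4⟩ := N.exists_mem_window (fun e => Nat.cast_nonneg (τ e)) hy.1
      (fun P => N.weight_le_sum_iff.1 (hy.2 P)) hα hα' P (s := n - u) (by linarith) (by linarith)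
    rw [Finset.mem_biUnion]
    refine ⟨e, he, Finset.mem_image.2 ⟨n + (∑ p ∈ N.before P e, τ p : ℕ), ?_, by ring⟩⟩
    rw [Finset.mem_Ico, Int.ceil_le, Int.lt_ceil]
    push_cast
    constructor <;> linarith
  have hcard := (Finset.card_le_card hsub).trans (Finset.card_biUnion_le.trans
    (Finset.sum_le_sum fun e _ => Finset.card_image_le))
  simp only [Int.card_Icc, Int.card_Ico, add_sub_cancel_right] at hcard
  have hZ : (T : ℤ) - (∑ e ∈ N.elems P, τ e : ℕ) ≤
      ((∑ e ∈ N.elems P, (⌈α e + y e + u⌉ - ⌈α e + u⌉).toNat : ℕ) : ℤ) :=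
    (Int.self_le_toNat _).trans (by exact_mod_cast hcard)
  have hR : ((T : ℤ) : ℝ) - ((∑ e ∈ N.elems P, τ e : ℕ) : ℤ) ≤
      (((∑ e ∈ N.elems P, (⌈α e + y e + u⌉ - ⌈α e + u⌉).toNat : ℕ) : ℤ) : ℝ) := by
    rw [← Int.cast_sub]
    exact Int.cast_le.2 hZ
  simpa only [weight, Int.cast_natCast, Nat.cast_sum, Int.cast_sum] using hR

/-- The rounded value at `e` averages to `y e` over thresholds in `(0, 1]`, so some threshold costs
at most the average. -/
theorem exists_nat_isWeightedCut_le [Fintype E] [Finite ι] {c : E → ℝ} {τ : E → ℕ}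
    {T : ℕ} {y : E → ℝ} (hy : N.IsWeightedCut (N.weight τ T) y) :
    ∃ z : E → ℕ, N.IsWeightedCut (N.weight τ T) (fun e => (z e : ℝ)) ∧
      ∑ e, c e * z e ≤ ∑ e, c e * y e := by
  obtain ⟨α, hα, hα'⟩ := N.exists_shortest_before fun e => (τ e : ℝ) + y e
  let F : ℝ → ℝ := fun u => ∑ e, c e * ((⌈α e + y e + u⌉ : ℝ) - ⌈α e + u⌉)
  have hi : ∀ e, IntervalIntegrable (fun u => c e * ((⌈α e + y e + u⌉ : ℝ) - ⌈α e + u⌉))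
      MeasureTheory.volume 0 1 := fun e =>
    ((intervalIntegrable_ceil_add _).sub (intervalIntegrable_ceil_add _)).const_mul _
  have hF : ∫ u in (0 : ℝ)..1, F u = ∑ e, c e * y e := by
    rw [intervalIntegral.integral_finsetSum fun e _ => hi e]
    refine Finset.sum_congr rfl fun e _ => ?_
    rw [intervalIntegral.integral_const_mul, integral_ceil_add_sub_ceil_add, add_sub_cancel_left]
  have hFi : IntervalIntegrable F MeasureTheory.volume 0 1 := by
    have := IntervalIntegrable.sum Finset.univ fun e _ => hi e
    have hFe : F = ∑ e, fun u => c e * ((⌈α e + y e + u⌉ : ℝ) - ⌈α e + u⌉) := by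
      ext u
      simp [F]
    rwa [hFe]
  obtain ⟨u, hu, hle⟩ := MeasureTheory.exists_le_setAverage (μ := MeasureTheory.volume)
    (s := Set.Ioc (0 : ℝ) 1) (f := F) (by simp) (by simp)
    ((intervalIntegrable_iff_integrableOn_Ioc_of_le zero_le_one).1 hFi)
  rw [MeasureTheory.setAverage_eq, ← intervalIntegral.integral_of_le zero_le_one, hF] at hle
  refine ⟨_, N.isWeightedCut_ceil_sub_ceil hy hα hα' hu.1 hu.2, ?_⟩
  refine le_trans (le_of_eq ?_) (hle.trans_eq (by simp))
  refine Finset.sum_congr rfl fun e _ => ?_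
  have h0 : 0 ≤ ⌈α e + y e + u⌉ - ⌈α e + u⌉ :=
    sub_nonneg.2 (Int.ceil_mono (by linarith [hy.1 e]))
  congr 1
  exact_mod_cast congrArg (Int.cast : ℤ → ℝ) (Int.toNat_of_nonneg h0)

/-- Capping a weighted abstract cut at `T`. -/
theorem isWeightedCut_min {τ : E → ℕ} {T : ℕ} {z : E → ℕ}
    (hz : N.IsWeightedCut (N.weight τ T) (fun e => (z e : ℝ))) :
    N.IsWeightedCut (N.weight τ T) (fun e => ((min (z e) T : ℕ) : ℝ)) := by
  refine ⟨fun e => Nat.cast_nonneg _, fun P => ?_⟩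
  by_cases h : ∃ e ∈ N.elems P, T ≤ z e
  · obtain ⟨e, he, hle⟩ := h
    calc N.weight τ T P ≤ T := sub_le_self _ (Finset.sum_nonneg fun e _ => Nat.cast_nonneg _)
      _ = ((min (z e) T : ℕ) : ℝ) := by rw [min_eq_right hle]
      _ ≤ _ := Finset.single_le_sum (f := fun e => ((min (z e) T : ℕ) : ℝ))
        (fun _ _ => Nat.cast_nonneg _) he
  · push Not at h
    refine (hz.2 P).trans_eq (Finset.sum_congr rfl fun e he => ?_)
    simp only [min_eq_left (h e he).le]

/-- Total dual integrality. -/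
theorem exists_nat_isWeightedCut_eq [Fintype E] [Fintype ι] {c : E → ℝ} (hc : ∀ e, 0 ≤ c e)
    (hne : ∀ P, (N.elems P).Nonempty) {τ : E → ℕ} {T : ℕ} {x : ι → ℝ}
    (hx : N.IsMaxWeightedFlow c (N.weight τ T) x) :
    ∃ y : E → ℕ, N.IsWeightedCut (N.weight τ T) (fun e => (y e : ℝ)) ∧
      ∑ e, c e * y e = ∑ P, N.weight τ T P * x P := by
  have key : ∀ B, ∑ P, N.weight τ T P * x P < B → ∃ z : E → ℕ, (∀ e, z e ≤ T) ∧
      N.IsWeightedCut (N.weight τ T) (fun e => (z e : ℝ)) ∧ ∑ e, c e * z e < B := by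
    intro B hB
    obtain ⟨y, hy, hyB⟩ := N.exists_isWeightedCut_lt hc hne hx hB
    obtain ⟨z, hz, hzy⟩ := N.exists_nat_isWeightedCut_le (c := c) hy
    refine ⟨fun e => min (z e) T, fun e => min_le_right _ _, N.isWeightedCut_min hz, ?_⟩
    refine lt_of_le_of_lt (Finset.sum_le_sum fun e _ => ?_) (hzy.trans_lt hyB)
    exact mul_le_mul_of_nonneg_left (by exact_mod_cast min_le_left _ _) (hc e)
  -- Capping leaves finitely many candidates, so the cheapest one removes the arbitrarily small
  -- error.
  let S : Set (E → ℕ) := {z | (∀ e, z e ≤ T) ∧ N.IsWeightedCut (N.weight τ T) fun e => (z e : ℝ)}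
  have hfin : S.Finite := (Set.Finite.pi' fun _ : E => Set.finite_Iic T).subset fun z hz => hz.1
  obtain ⟨z₀, hz₀, hz₀', -⟩ := key _ (lt_add_one _)
  obtain ⟨y, hy, hmin⟩ := Set.exists_min_image S (fun z => ∑ e, c e * z e) hfin ⟨z₀, hz₀, hz₀'⟩
  refine ⟨y, hy.2, le_antisymm (le_of_forall_gt fun B hB => ?_) (hx.1.sum_le N hy.2)⟩
  obtain ⟨z, hz, hz', hzB⟩ := key B hB
  exact (hmin z ⟨hz, hz'⟩).trans_lt hzB

end Rounding

/-! ### Flows and cuts over time -/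

section OverTime

variable {E ι : Type*} (N : AbstractNetwork E ι)

/-- Weak duality over time. -/
theorem IsFlowOverTime.sum_le [Fintype ι] {c : E → ℝ} {τ : E → ℕ} {T : ℕ}
    {x : N.TemporalPath τ T → ℝ} (hx : N.IsFlowOverTime c τ T x) {C : Finset (E × Fin T)}
    (hC : N.IsCutOverTime τ T C) : ∑ p, x p ≤ ∑ a ∈ C, c a.1 := by
  classical
  calc ∑ p, x p ≤ ∑ p, ∑ a ∈ C, if a ∈ TemporalPath.elems p then x p else 0 := by
        refine Finset.sum_le_sum fun p _ => ?_
        obtain ⟨a, ha, hap⟩ := hC p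
        refine le_trans (le_of_eq ?_) (Finset.single_le_sum
          (f := fun a => if a ∈ TemporalPath.elems p then x p else 0) (fun b _ => ?_) ha)
        · simp [hap]
        · split_ifs
          exacts [hx.1 p, le_rfl]
    _ = ∑ a ∈ C, ∑ p, if a ∈ TemporalPath.elems p then x p else 0 := Finset.sum_comm
    _ ≤ ∑ a ∈ C, c a.1 := by
        refine Finset.sum_le_sum fun a _ => ?_
        rw [← Finset.sum_filter]
        convert hx.2 a.1 a.2

/-- For fixed `(e, θ)` the path `P` determines its starting time, so at most one copy of each static
path uses `(e, θ)`. -/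
theorem IsFlow.temporallyRepeated [Fintype ι] {c : E → ℝ} {x : ι → ℝ} (hx : N.IsFlow c x)
    (τ : E → ℕ) (T : ℕ) : N.IsFlowOverTime c τ T (N.temporallyRepeated τ T x) := by
  classical
  refine ⟨fun p => hx.1 _, fun e θ => le_trans ?_ (hx.2 e)⟩
  have hinj : Set.InjOn (fun p : N.TemporalPath τ T => p.1.1)
      (Finset.univ.filter fun p => (e, θ) ∈ TemporalPath.elems p : Finset (N.TemporalPath τ T)) := by
    rintro ⟨⟨P, t⟩, hp⟩ h1 ⟨⟨Q, t'⟩, hq⟩ h2 (rfl : P = Q)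
    have h3 := (Finset.mem_filter.1 h1).2.2
    have h4 := (Finset.mem_filter.1 h2).2.2
    simp only at h3 h4
    have : t = t' := Fin.ext (by omega)
    subst this
    rfl
  calc _ = ∑ p with (e, θ) ∈ TemporalPath.elems p, x (p : N.TemporalPath τ T).1.1 := by
        congr!
    _ = ∑ P ∈ (Finset.univ.filter fun p => (e, θ) ∈ TemporalPath.elems p).image
          fun p : N.TemporalPath τ T => p.1.1, x P := (Finset.sum_image hinj).symm
    _ ≤ _ := by
        refine Finset.sum_le_sum_of_subset_of_nonneg ?_ fun P _ _ => hx.1 P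
        intro P hP
        obtain ⟨p, hp, rfl⟩ := Finset.mem_image.1 hP
        simpa using (Finset.mem_filter.1 hp).2.1

/-- `P` has `max (r(P)) 0` temporal copies; the inequality absorbs negative weights. -/
theorem sum_weight_mul_le [Fintype ι] {x : ι → ℝ} (hx : ∀ P, 0 ≤ x P) (τ : E → ℕ) (T : ℕ) :
    ∑ P, N.weight τ T P * x P ≤ ∑ p, N.temporallyRepeated τ T x p := by
  classical
  have h1 : ∑ p, N.temporallyRepeated τ T x p = ∑ P, ∑ t : Fin T,
      if (t : ℕ) + ∑ e ∈ N.elems P, τ e < T then x P else 0 := by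
    rw [← Fintype.sum_prod_type', ← Finset.sum_filter]
    exact (Finset.sum_subtype (Finset.univ.filter fun p : ι × Fin T =>
      (p.2 : ℕ) + ∑ e ∈ N.elems p.1, τ e < T) (by simp) fun p => x p.1).symm
  rw [h1]
  refine Finset.sum_le_sum fun P _ => ?_
  rw [← Finset.sum_filter, Finset.sum_const, nsmul_eq_mul]
  refine mul_le_mul_of_nonneg_right ?_ (hx P)
  have h2 : (Finset.range (T - ∑ e ∈ N.elems P, τ e)).card ≤
      (Finset.univ.filter fun t : Fin T => (t : ℕ) + ∑ e ∈ N.elems P, τ e < T).card := by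
    refine (Finset.card_le_card (t := (Finset.univ.filter fun t : Fin T =>
      (t : ℕ) + ∑ e ∈ N.elems P, τ e < T).image Fin.val) fun n hn => ?_).trans
        Finset.card_image_le
    have := Finset.mem_range.1 hn
    exact Finset.mem_image.2 ⟨⟨n, by omega⟩, by simp; omega, rfl⟩
  rw [Finset.card_range, tsub_le_iff_right] at h2
  rw [weight, sub_le_iff_le_add]
  exact_mod_cast h2

theorem exists_entryTime_eq [Finite ι] (τ y : E → ℕ) {P : ι} {e : E} (he : e ∈ N.elems P) :
    ∃ Q, e ∈ N.elems Q ∧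
      N.entryTime τ y e = ((∑ p ∈ N.before Q e, (τ p + y p) : ℕ) : ℕ∞) := by
  obtain ⟨Q, hQ, hmin⟩ := Set.exists_min_image {P | e ∈ N.elems P}
    (fun P => ∑ p ∈ N.before P e, (τ p + y p)) (Set.toFinite _) ⟨P, he⟩
  refine ⟨Q, hQ, le_antisymm (iInf₂_le Q hQ) (le_iInf₂ fun R hR => ?_)⟩
  exact_mod_cast hmin R hR

theorem isCutOverTime_cutOverTime [Fintype E] [Finite ι] {τ y : E → ℕ} {T : ℕ}
    (hy : N.IsWeightedCut (N.weight τ T) (fun e => (y e : ℝ))) :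
    N.IsCutOverTime τ T (N.cutOverTime τ T y) := by
  rintro ⟨⟨P, t⟩, hp⟩
  simp only at hp
  -- The junk value of `toNat` at `∞` concerns only elements on no path.
  let α : E → ℕ := fun e => (N.entryTime τ y e).toNat
  have hα : ∀ P, ∀ e ∈ N.elems P, N.entryTime τ y e = α e := fun P e he => by
    obtain ⟨Q, -, h⟩ := N.exists_entryTime_eq τ y he
    simp only [α, h, ENat.toNat_natCast]
  obtain ⟨e, he, h1, h2⟩ := N.exists_mem_window (τ := fun e => (τ e : ℝ))
    (y := fun e => (y e : ℝ)) (α := fun e => (α e : ℝ)) (T := T) (s := (t : ℕ))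
    (fun e => Nat.cast_nonneg _) (fun e => Nat.cast_nonneg _)
    (fun P => N.weight_le_sum_iff.1 (hy.2 P))
    (fun P e he => by
      have h : N.entryTime τ y e ≤ _ := iInf₂_le P he
      rw [hα P e he] at h
      exact_mod_cast h)
    (fun P e he => by
      obtain ⟨Q, hQ, h⟩ := N.exists_entryTime_eq τ y he
      rw [hα P e he] at h
      refine ⟨Q, hQ, ?_⟩
      exact_mod_cast h.symm)
    P (Nat.cast_nonneg _) (by exact_mod_cast hp)
  have hlt : (t : ℕ) + ∑ p ∈ N.before P e, τ p < T := by
    refine lt_of_le_of_lt (Nat.add_le_add_left ?_ _) hp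
    exact Finset.sum_le_sum_of_subset fun a ha => (N.mem_before.1 ha).1
  refine ⟨(e, ⟨_, hlt⟩), ?_, he, rfl⟩
  simp only [cutOverTime, Finset.mem_filter, Finset.mem_univ, true_and]
  rw [hα P e he]
  exact ⟨by exact_mod_cast h1, by exact_mod_cast h2⟩

/-- A window contains at most `y e` integers; the horizon may truncate it, and it is empty if `α(e)
= ∞`. -/
theorem sum_cutOverTime_le [Fintype E] {c : E → ℝ} (hc : ∀ e, 0 ≤ c e) (τ : E → ℕ) (T : ℕ)
    (y : E → ℕ) : ∑ a ∈ N.cutOverTime τ T y, c a.1 ≤ ∑ e, c e * y e := by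
  classical
  rw [cutOverTime, Finset.sum_filter, Fintype.sum_prod_type]
  refine Finset.sum_le_sum fun e _ => ?_
  dsimp only
  rw [← Finset.sum_filter, Finset.sum_const, nsmul_eq_mul, mul_comm]
  refine mul_le_mul_of_nonneg_left (Nat.cast_le.2 ?_) (hc e)
  obtain h | h := eq_or_ne (N.entryTime τ y e) ⊤
  · simp [h]
  obtain ⟨k, hk⟩ := ENat.ne_top_iff_exists.1 h
  simp only [← hk]
  refine (Finset.card_le_card_of_injOn Fin.val (t := Finset.Ico k (k + y e)) ?_
    Fin.val_injective.injOn).trans_eq (by simp)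
  intro θ hθ
  simp only [Finset.coe_filter, Finset.mem_univ, true_and] at hθ
  simp only [Finset.coe_Ico]
  exact ⟨by exact_mod_cast hθ.1, by exact_mod_cast hθ.2⟩

theorem nonempty_or_eq_zero [Fintype E] {τ : E → ℕ} {T : ℕ} {y : E → ℝ}
    (hy : N.IsWeightedCut (N.weight τ T) y) : (∀ P, (N.elems P).Nonempty) ∨ T = 0 := by
  by_contra! h
  obtain ⟨⟨P, hP⟩, hT⟩ := h
  have := hy.2 P
  rw [weight, hP] at this
  simp only [Finset.sum_empty, sub_zero] at this
  exact hT (Nat.le_zero.1 (by exact_mod_cast this))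

end OverTime

/-! ### Existence of optimal solutions and the degenerate case `T = 0` -/

section Existence

variable {E ι : Type*} [Fintype ι] (N : AbstractNetwork E ι)

theorem nonempty_or_eq_zero_of_isMaxWeightedFlow {c : E → ℝ} {τ : E → ℕ} {T : ℕ} {x : ι → ℝ}
    (hx : N.IsMaxWeightedFlow c (N.weight τ T) x) : (∀ P, (N.elems P).Nonempty) ∨ T = 0 := by
  classical
  by_contra! h
  obtain ⟨⟨P, hP⟩, hT⟩ := h
  have h0 : ∀ Q, 0 ≤ (Pi.single P 1 : ι → ℝ) Q := fun Q => by
    by_cases h : Q = P <;> simp [h]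
  -- An empty path uses no capacity, so one more unit along it stays feasible and gains `T`.
  have hle := hx.2 (x + Pi.single P 1) ⟨fun Q => add_nonneg (hx.1.1 Q) (h0 Q), fun e => by
    refine le_trans (le_of_eq (Finset.sum_congr rfl fun Q hQ => ?_)) (hx.1.2 e)
    have : Q ≠ P := by
      rintro rfl
      simp [hP] at hQ
    simp [this]⟩
  simp only [Pi.add_apply, mul_add, Finset.sum_add_distrib, Pi.single_apply, mul_ite, mul_one,
    mul_zero, Finset.sum_ite_eq', Finset.mem_univ, if_true] at hle
  have hw : N.weight τ T P = T := by simp [weight, hP]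
  rw [hw] at hle
  exact hT (by exact_mod_cast (by linarith : (T : ℝ) ≤ 0).antisymm (Nat.cast_nonneg T))

/-- The static problems have optimal solutions of equal value, the dual one being integral. -/
theorem exists_isFlow_isWeightedCut_eq [Fintype E] {c : E → ℝ} (hc : ∀ e, 0 ≤ c e) {τ : E → ℕ} {T : ℕ}
    (h : (∀ P, (N.elems P).Nonempty) ∨ T = 0) :
    ∃ (x : ι → ℝ) (y : E → ℕ), N.IsFlow c x ∧
      N.IsWeightedCut (N.weight τ T) (fun e => (y e : ℝ)) ∧
      ∑ e, c e * y e = ∑ P, N.weight τ T P * x P := by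
  obtain hne | rfl := h
  · obtain ⟨x, hx⟩ := N.exists_isMaxWeightedFlow hc hne (N.weight τ T)
    obtain ⟨y, hy⟩ := N.exists_nat_isWeightedCut_eq hc hne hx
    exact ⟨x, y, hx.1, hy⟩
  · refine ⟨0, 0, N.isFlow_zero hc, ⟨fun _ => by simp, fun P => ?_⟩, by simp⟩
    simp only [weight, Pi.zero_apply, Nat.cast_zero, Finset.sum_const_zero, zero_sub]
    exact neg_nonpos.2 (Finset.sum_nonneg fun e _ => Nat.cast_nonneg _)

end Existence

end AbstractNetwork

theorem mainTheorem4 {E ι : Type*} [Fintype E] [Fintype ι] (N : AbstractNetwork E ι)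
    (c : E → ℝ) (hc : ∀ e, 0 ≤ c e) (τ : E → ℕ) (T : ℕ) :
    -- every optimal static flow, repeated over time, is a maximum flow over time
    (∀ x : ι → ℝ, N.IsMaxWeightedFlow c (N.weight τ T) x →
      N.IsMaxFlowOverTime c τ T (N.temporallyRepeated τ T x)) ∧
    -- every integral optimal dual solution gives a minimum cut over time, of the same value
    (∀ y : E → ℕ, N.IsMinWeightedCut c (N.weight τ T) (fun e => (y e : ℝ)) →
      N.IsMinCutOverTime c τ T (N.cutOverTime τ T y) ∧
      ∀ x : ι → ℝ, N.IsMaxWeightedFlow c (N.weight τ T) x →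
        ∑ a ∈ N.cutOverTime τ T y, c a.1 = ∑ p, N.temporallyRepeated τ T x p) ∧
    -- optimal static flows and integral optimal dual solutions exist
    ((∀ P, (N.elems P).Nonempty) →
      (∃ x : ι → ℝ, N.IsMaxWeightedFlow c (N.weight τ T) x) ∧
      ∃ y : E → ℕ, N.IsMinWeightedCut c (N.weight τ T) (fun e => (y e : ℝ))) := by
  refine ⟨fun x hx => ?_, fun y hy => ?_, fun hne => ?_⟩
  · obtain ⟨x₀, y, hx₀, hy, heq⟩ := N.exists_isFlow_isWeightedCut_eq hc
      (N.nonempty_or_eq_zero_of_isMaxWeightedFlow hx)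
    refine ⟨hx.1.temporallyRepeated N τ T, fun x' hx' => ?_⟩
    calc ∑ p, x' p ≤ ∑ a ∈ N.cutOverTime τ T y, c a.1 :=
          hx'.sum_le N (N.isCutOverTime_cutOverTime hy)
      _ ≤ ∑ e, c e * y e := N.sum_cutOverTime_le hc τ T y
      _ = ∑ P, N.weight τ T P * x₀ P := heq
      _ ≤ ∑ P, N.weight τ T P * x P := hx.2 x₀ hx₀
      _ ≤ _ := N.sum_weight_mul_le hx.1.1 τ T
  · obtain ⟨x₀, y₀, hx₀, hy₀, heq⟩ := N.exists_isFlow_isWeightedCut_eq hc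
      (N.nonempty_or_eq_zero hy.1)
    have hle : ∑ a ∈ N.cutOverTime τ T y, c a.1 ≤ ∑ P, N.weight τ T P * x₀ P :=
      (N.sum_cutOverTime_le hc τ T y).trans ((hy.2 _ hy₀).trans_eq heq)
    have hcut := N.isCutOverTime_cutOverTime hy.1
    refine ⟨⟨hcut, fun C' hC' => ?_⟩, fun x hx => le_antisymm ?_ ?_⟩
    · exact hle.trans ((N.sum_weight_mul_le hx₀.1 τ T).trans
        ((hx₀.temporallyRepeated N τ T).sum_le N hC'))
    · exact hle.trans ((hx.2 x₀ hx₀).trans (N.sum_weight_mul_le hx.1.1 τ T))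
    · exact (hx.1.temporallyRepeated N τ T).sum_le N hcut
  · obtain ⟨x, y, hx, hy, heq⟩ :=
      N.exists_isFlow_isWeightedCut_eq hc (τ := τ) (T := T) (Or.inl hne)
    exact ⟨⟨x, hx, fun x' hx' => (hx'.sum_le N hy).trans_eq heq⟩,
      ⟨y, hy, fun y' hy' => heq.trans_le (hx.sum_le N hy')⟩⟩
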